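/- Let $\widehat{\mathfrak{sl}}_3=\mathfrak{sl}_3(\mathbb C)\otimes\mathbb C[t,t^{-1}]\oplus\mathbb C\mathsf c$ be the affine Lie algebra of type $A_2^{(1)}$, with bracket $[x t^n,y t^m]=[x,y]t^{n+m}+n\delta_{n,-m}\operatorname{tr}(xy)\,\mathsf c$ and $\mathsf c$ central, and let $\widehat{\mathfrak n}^+$ be its positive subalgebra, generated by $e_1=E_{12}$, $e_2=E_{23}$, $e_0=E_{31}t$. Consider words in the alphabet $\{0,1,2\}$ ordered by $1<2<0$, compared lexicographically (a proper prefix of a word is smaller than the word). A nonempty word is Lyndon if it is smaller than all of its proper suffixes. The standard bracketing of a Lyndon word is defined by $\mathsf b[i]=e_i$ and $\mathsf b[\ell]=[\mathsf b[\ell_1],\mathsf b[\ell_2]]$, where $\ell=\ell_1\ell_2$ and $\ell_2$ is the longest proper suffix of $\ell$ that is Lyndon. A Lyndon word $\ell$ is an affine standard Lyndon word if $\mathsf b[\ell]\in\widehat{\mathfrak n}^+$ is not a linear combination of the elements $\mathsf b[m]$ with $m>\ell$ Lyndon. The degree of $[i_1\dots i_r]$ is $\alpha_{i_1}+\dots+\alpha_{i_r}$,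 where $\alpha_0,\alpha_1,\alpha_2$ are the simple roots, and $\delta=\alpha_0+\alpha_1+\alpha_2$. Write $(102)^k$ for the word $102$ repeated $k$ times. **Theorem.** The degree of every affine standard Lyndon word is a positive root, that is, one of $k\delta+\alpha_1$, $k\delta+\alpha_2$, $k\delta+\alpha_0$, $k\delta+\alpha_1+\alpha_2$, $k\delta+\alpha_1+\alpha_0$, $k\delta+\alpha_2+\alpha_0$, $(k+1)\delta$ with $k\ge 0$. There is exactly one affine standard Lyndon word $\mathrm{SL}(\alpha)$ in each real degree $\alpha$ (the first six families), and there are exactly two, $\mathrm{SL}_1(\alpha)>\mathrm{SL}_2(\alpha)$, in each imaginary degree $\alpha=(k+1)\delta$. They are as follows. For $k\ge1$: $$\mathrm{SL}(k\delta+\alpha_1)=12(102)^{k-1}10,\qquad \mathrm{SL}(k\delta+\alpha_2)=(102)^k2,\qquad \mathrm{SL}(k\delta+\alpha_0)=(102)^k0,$$ $$\mathrm{SL}(k\delta+\alpha_1+\alpha_2)=12(102)^k,\qquad \mathrm{SL}(k\delta+\alpha_1+\alpha_0)=10(102)^k,$$ $$\mathrm{SL}(k\delta+\alpha_2+\alpha_0)=\begin{cases}(102)^{k/2}\,2\,(102)^{k/2}\,0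 & \text{if } k \text{ is even},\\ (102)^{(k+1)/2}\,0\,(102)^{(k-1)/2}\,2 & \text{if } k\text{ is odd},\end{cases}$$ $$\mathrm{SL}_1((k+1)\delta)=10(102)^k2,\qquad \mathrm{SL}_2((k+1)\delta)=12(102)^k0.$$ For the remaining roots: $$\mathrm{SL}(\alpha_1)=1,\quad \mathrm{SL}(\alpha_2)=2,\quad \mathrm{SL}(\alpha_0)=0,\quad \mathrm{SL}(\alpha_1+\alpha_2)=12,\quad \mathrm{SL}(\alpha_1+\alpha_0)=10,\quad \mathrm{SL}(\alpha_2+\alpha_0)=20,$$ $$\mathrm{SL}_1(\delta)=102,\qquad \mathrm{SL}_2(\delta)=120.$$ -/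

import Mathlib

open scoped TensorProduct

noncomputable section

/-! ### Lyndon words

Words over an ordered alphabet `I` are lists; `<` on `List I` is the lexicographical order, in which
a proper prefix of a word is smaller than the word. -/

section Words

variable {I : Type*} [LinearOrder I]

/-- A nonempty word is Lyndon if it is smaller than all of its proper suffixes. -/
def IsLyndonWord (w : List I) : Prop :=
  w ≠ [] ∧ ∀ n : ℕ, 0 < n → n < w.length → w < w.drop n

theorem isLyndonWord_singleton (i : I) : IsLyndonWord [i] := by
  refine ⟨by simp, fun n h0 h1 => ?_⟩
  simp only [List.length_singleton] at h1
  omega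

theorem exists_lyndon_suffix (i j : I) (w : List I) :
    ∃ n : ℕ, 0 < n ∧ IsLyndonWord ((i :: j :: w).drop n) := by
  have hne : (i :: j :: w) ≠ [] := by simp
  refine ⟨w.length + 1, by omega, ?_⟩
  have h := List.drop_length_sub_one hne
  have hl : (i :: j :: w).length - 1 = w.length + 1 := by simp
  rw [hl] at h
  rw [h]
  exact isLyndonWord_singleton _

open Classical in
/-- The length of the left factor `ℓ₁` of the costandard factorization `ℓ = ℓ₁ ℓ₂` of a word of
length at least two: `ℓ₂` is the longest proper suffix that is Lyndon. -/
def costandardIndex (i j : I) (w : List I) : ℕ :=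
  Nat.find (exists_lyndon_suffix i j w)

theorem costandardIndex_pos (i j : I) (w : List I) : 0 < costandardIndex i j w := by
  classical
  exact (Nat.find_spec (exists_lyndon_suffix i j w)).1

theorem costandardIndex_lt (i j : I) (w : List I) :
    costandardIndex i j w < (i :: j :: w).length := by
  classical
  by_contra h
  have h2 := (Nat.find_spec (exists_lyndon_suffix i j w)).2.1
  exact h2 (List.drop_eq_nil_of_le (not_lt.mp h))

variable {L : Type*} [LieRing L]

/-- The standard bracketing `b[ℓ]` (meant for Lyndon words `ℓ`; the value at the empty word is
irrelevant): `b[i] = e i`, and `b[ℓ] = ⁅b[ℓ₁], b[ℓ₂]⁆` for the costandard factorization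
`ℓ = ℓ₁ ℓ₂`. -/
def stdBracketing (e : I → L) : List I → L
  | [] => 0
  | [i] => e i
  | i :: j :: w =>
    ⁅stdBracketing e ((i :: j :: w).take (costandardIndex i j w)),
      stdBracketing e ((i :: j :: w).drop (costandardIndex i j w))⁆
termination_by w => w.length
decreasing_by
  · have h := costandardIndex_lt i j w
    rw [List.length_take]
    exact lt_of_le_of_lt (min_le_left _ _) h
  · have h := costandardIndex_pos i j w
    rw [List.length_drop]
    simp only [List.length_cons]
    omega

/-- A Lyndon word `ℓ` is standard Lyndon, with respect to a Lie algebra `L` over `R` generated by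
the elements `e i`, if `b[ℓ]` is not a linear combination of the `b[m]` for Lyndon words `m > ℓ`. -/
def IsStandardLyndonWord (R : Type*) [CommRing R] [LieAlgebra R L] (e : I → L) (w : List I) :
    Prop :=
  IsLyndonWord w ∧
    stdBracketing e w ∉
      Submodule.span R {x : L | ∃ m : List I, IsLyndonWord m ∧ w < m ∧ stdBracketing e m = x}

end Words

/-! ### The affine Lie algebra of `sl₃` -/

/-- The Lie algebra `sl₃(ℂ)` of traceless matrices. -/
abbrev SL3 : Type := LieAlgebra.SpecialLinear.sl (Fin 3) ℂ

/-- The invariant symmetric pairing `(x, y) = tr (x y)` on `sl₃(ℂ)`. -/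
def sl3Pairing : LinearMap.BilinForm ℂ SL3 :=
  LinearMap.mk₂ ℂ (fun x y => Matrix.trace (x.val * y.val))
    (by intro x y z; simp [add_mul])
    (by intro c x y; simp)
    (by intro x y z; simp [mul_add])
    (by intro c x y; simp)

theorem sl3Pairing_apply (x y : SL3) : sl3Pairing x y = Matrix.trace (x.val * y.val) := rfl

theorem neg_sl3Pairing_isSymm : (-sl3Pairing).IsSymm :=
  ⟨fun x y => by simp [sl3Pairing_apply, Matrix.trace_mul_comm x.val y.val]⟩

theorem neg_sl3Pairing_lieInvariant : (-sl3Pairing).lieInvariant SL3 := by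
  intro x y z
  simp only [LinearMap.neg_apply, sl3Pairing_apply, LieAlgebra.SpecialLinear.sl_bracket,
    Matrix.sub_mul, Matrix.mul_sub, Matrix.trace_sub, neg_neg]
  rw [Matrix.mul_assoc y.val x.val z.val, Matrix.mul_assoc x.val y.val z.val,
    ← Matrix.mul_assoc y.val z.val x.val, Matrix.trace_mul_comm x.val (y.val * z.val)]
  ring

/-- The cocycle `(x tⁿ, y tᵐ) ↦ n δ_{n,-m} (x, y)` on the loop algebra `sl₃ ⊗ ℂ[t, t⁻¹]`.
The residue cocycle of a form `Φ` is `(x tⁿ, y tᵐ) ↦ m δ_{n,-m} Φ(x, y)`, whence the sign. -/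
abbrev affineSL3Cocycle :
    LieModule.Cohomology.twoCocycle ℂ (LieAlgebra.loopAlgebra ℂ ℤ SL3)
      (TrivialLieModule ℂ (LieAlgebra.loopAlgebra ℂ ℤ SL3) ℂ) :=
  LieAlgebra.LoopAlgebra.twoCocycleOfBilinear ℂ ℤ SL3 (-sl3Pairing)
    neg_sl3Pairing_lieInvariant neg_sl3Pairing_isSymm

/-- The affine Lie algebra of type `A₂⁽¹⁾`, realized as `sl₃ ⊗ ℂ[t, t⁻¹] ⊕ ℂ c`. -/
abbrev AffineSL3 : Type := LieAlgebra.ofTwoCocycle affineSL3Cocycle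

/-- The element `x ⊗ tⁿ` of the affine Lie algebra. -/
def loopElem (x : SL3) (n : ℤ) : AffineSL3 :=
  LieAlgebra.ofProd affineSL3Cocycle (AddMonoidAlgebra.single n (1 : ℂ) ⊗ₜ[ℂ] x, 0)

/-- The alphabet `{0, 1, 2}` of vertices of the affine Dynkin diagram. -/
inductive AffineLetter : Type
  | l1
  | l2
  | l0
  deriving DecidableEq

namespace AffineLetter

/-- The position of a letter in the order `1 < 2 < 0`. -/
def rank : AffineLetter → ℕ
  | l1 => 0
  | l2 => 1
  | l0 => 2

theorem rank_injective : Function.Injective rank := by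
  intro a b h
  cases a <;> cases b <;> simp_all [rank]

/-- The alphabet is ordered by `1 < 2 < 0`. -/
instance : LinearOrder AffineLetter := LinearOrder.lift' rank rank_injective

end AffineLetter

/-- The Chevalley generators `e₁ = E₁₂`, `e₂ = E₂₃`, `e₀ = E₃₁ t`
(`Fin 3` numbers rows and columns from `0`). -/
def affineGenerator : AffineLetter → AffineSL3
  | .l1 => loopElem (LieAlgebra.SpecialLinear.single (0 : Fin 3) 1 (by decide) 1) 0
  | .l2 => loopElem (LieAlgebra.SpecialLinear.single (1 : Fin 3) 2 (by decide) 1) 0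
  | .l0 => loopElem (LieAlgebra.SpecialLinear.single (2 : Fin 3) 0 (by decide) 1) 1

/-- The positive subalgebra of the affine Lie algebra, generated by `e₀`, `e₁`, `e₂`. -/
def affineNilPos : LieSubalgebra ℂ AffineSL3 :=
  LieSubalgebra.lieSpan ℂ AffineSL3 (Set.range affineGenerator)

/-- The generators `e₀`, `e₁`, `e₂` of the positive subalgebra. -/
def affineE (i : AffineLetter) : affineNilPos :=
  ⟨affineGenerator i, LieSubalgebra.subset_lieSpan ⟨i, rfl⟩⟩

/-- Affine standard Lyndon words of `sl₃` for the order `1 < 2 < 0`. -/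
def IsAffineStandardLyndon (w : List AffineLetter) : Prop :=
  IsStandardLyndonWord ℂ affineE w

/-! ### Degrees and roots -/

/-- The simple root `α_i`, in the positive cone `ℕ α₀ ⊕ ℕ α₁ ⊕ ℕ α₂` of the root lattice. -/
def simpleRoot (i : AffineLetter) : AffineLetter → ℕ := Pi.single i 1

/-- The minimal imaginary root `δ = α₀ + α₁ + α₂`. -/
def deltaRoot : AffineLetter → ℕ := simpleRoot .l0 + simpleRoot .l1 + simpleRoot .l2

/-- The degree `α_{i₁} + ⋯ + α_{i_k}` of the word `[i₁ … i_k]`. -/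
def wordDegree (w : List AffineLetter) : AffineLetter → ℕ := (w.map simpleRoot).sum

/-- The positive real roots `kδ + γ`, where `γ` is one of
`α₁`, `α₂`, `α₀`, `α₁ + α₂`, `α₁ + α₀`, `α₂ + α₀`. -/
def posRealRoots : Set (AffineLetter → ℕ) :=
  {β | ∃ k : ℕ, (∃ i, β = k • deltaRoot + simpleRoot i) ∨
    (∃ i j, i ≠ j ∧ β = k • deltaRoot + (simpleRoot i + simpleRoot j))}

/-- The positive imaginary roots `(k + 1)δ`. -/
def posImagRoots : Set (AffineLetter → ℕ) :=
  {β | ∃ k : ℕ, β = (k + 1) • deltaRoot}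

/-- The affine standard Lyndon words of degree `β`, listed in decreasing order, are exactly the
entries of `l`. Thus `AffineSL β [w]` says that `SL(β) = w`, and `AffineSL β [w₁, w₂]` says that
`SL₁(β) = w₁` and `SL₂(β) = w₂`. -/
def AffineSL (β : AffineLetter → ℕ) (l : List (List AffineLetter)) : Prop :=
  l.Pairwise (fun v w => w < v) ∧
    ∀ w, w ∈ l ↔ IsAffineStandardLyndon w ∧ wordDegree w = β

/-- The word `102` repeated `k` times. -/
def rep102 (k : ℕ) : List AffineLetter := (List.replicate k [.l1, .l0, .l2]).flatten

end

/-! Each root space of degree `kδ + γ` is modelled by a set of matrix positions and a power of `t`.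
Real root spaces are lines. The imaginary one is the Cartan subalgebra times a power of `t`,
filtered by the line `im1` of matrices diag(0, a, -a) inside the full diagonal `im2`. All powers of
`t` are nonnegative, so the cocycle plays no role.

Upper bound. Let `w = uv` be the costandard factorization of a Lyndon word. Both factors are Lyndon
and `uv < v`, hence `uv ≤ vu`. If the bracketing of `w` is nonzero, then by induction `u` and `v`
lie in known types and are at most the listed words `p` and `q` of these types, which have the same
lengths. So `w` is at most both `pq` and `qp`, and `word_sum_le` shows that one of these is at most
the listed word of the sum. This gives `stdBracketing_eq_zero_or_isBoundedWord`.

Lower bound. `isGenericWord_word` computes the bracketing of each listed word along its costandard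
factorization and finds a nonzero entry at a position detecting its type. No factor used has type
`im2`. This matters because diag(0, a, -a) with `a ≠ 0` acts nontrivially on every root vector,
whereas a general diagonal matrix need not.

Together: a matrix entry separates a listed word from all larger Lyndon words, so listed words are
standard. Any other Lyndon word has zero bracketing or lies below listed words whose bracketings
span its own, so it is not standard. -/

section WordLemmas

variable {I : Type*} [LinearOrder I]

/-! ### Lexicographic comparison of concatenations. -/

theorem List.cons_lt_cons_iff_of_linearOrder {a b : I} {u v : List I} :
    a :: u < b :: v ↔ a < b ∨ a = b ∧ u < v :=
  List.cons_lt_cons_iff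

theorem List.cons_le_cons_iff_of_linearOrder {a b : I} {u v : List I} :
    a :: u ≤ b :: v ↔ a < b ∨ a = b ∧ u ≤ v := by
  simp only [le_iff_lt_or_eq, List.cons_lt_cons_iff_of_linearOrder, List.cons.injEq]
  tauto

theorem List.append_lt_append_left_iff (u : List I) {v w : List I} :
    u ++ v < u ++ w ↔ v < w := by
  induction u with
  | nil => rfl
  | cons a u ih => simp [ih]

theorem List.append_le_append_left_iff (u : List I) {v w : List I} :
    u ++ v ≤ u ++ w ↔ v ≤ w := by
  induction u with
  | nil => rfl
  | cons a u ih => simp [List.cons_le_cons_iff_of_linearOrder, ih]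

theorem List.nil_le_of_linearOrder (v : List I) : [] ≤ v := by
  cases v with
  | nil => exact le_rfl
  | cons a v => exact le_of_lt (List.nil_lt_cons a v)

/-- The length hypothesis prevents `u` from being a proper prefix of `v`, so the comparison is
decided at a position inside both words and survives any continuation. -/
theorem List.append_lt_append_of_lt {u v : List I} (h : u < v) (hl : v.length ≤ u.length)
    (x y : List I) : u ++ x < v ++ y := by
  induction u generalizing v with
  | nil =>
    obtain rfl : v = [] := by simpa using hl
    exact absurd h (lt_irrefl _)
  | cons a u ih =>
    cases v with
    | nil => exact absurd h (List.not_lt_nil _)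
    | cons b v =>
      simp only [List.cons_append, List.cons_lt_cons_iff_of_linearOrder] at h ⊢
      exact h.imp_right fun h => ⟨h.1, ih h.2 (by simpa using hl)⟩

theorem List.append_le_append_of_le {u v : List I} (h : u ≤ v) (hl : v.length ≤ u.length)
    {x y : List I} (hxy : x ≤ y) : u ++ x ≤ v ++ y := by
  rcases h.lt_or_eq with h | rfl
  · exact (List.append_lt_append_of_lt h hl x y).le
  · exact (List.append_le_append_left_iff u).2 hxy

/-- Either `u` is a prefix of `v`, or the comparison is decided at a common position. -/
theorem List.prefix_or_append_lt_append {u v : List I} (h : u < v) :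
    u <+: v ∨ ∀ x y : List I, u ++ x < v ++ y := by
  induction u generalizing v with
  | nil => exact Or.inl (List.nil_prefix)
  | cons a u ih =>
    cases v with
    | nil => exact absurd h (List.not_lt_nil _)
    | cons b v =>
      simp only [List.cons_append, List.cons_lt_cons_iff_of_linearOrder] at h ⊢
      rcases h with h | ⟨rfl, h⟩
      · exact Or.inr fun _ _ => Or.inl h
      · rcases ih h with h | h
        · exact Or.inl (by simpa using h)
        · exact Or.inr fun x y => Or.inr ⟨rfl, h x y⟩

/-! ### Lyndon words and their suffixes. -/

theorem isLyndonWord_iff_append {w : List I} :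
    IsLyndonWord w ↔ w ≠ [] ∧ ∀ u v : List I, u ≠ [] → v ≠ [] → u ++ v = w → w < v := by
  refine and_congr_right fun _ => ⟨?_, ?_⟩
  · rintro h u v hu hv rfl
    have := h u.length (List.length_pos_iff.2 hu)
      (by simpa using List.length_pos_iff.2 hv)
    rwa [List.drop_left] at this
  · intro h n h0 h1
    refine h (w.take n) (w.drop n) ?_ ?_ (List.take_append_drop n w)
    · exact List.length_pos_iff.1 (by rw [List.length_take]; omega)
    · exact List.length_pos_iff.1 (by rw [List.length_drop]; omega)

/-- The concatenation of Lyndon words `u < v` is Lyndon. -/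
theorem IsLyndonWord.append {u v : List I} (hu : IsLyndonWord u) (hv : IsLyndonWord v)
    (h : u < v) : IsLyndonWord (u ++ v) := by
  rw [isLyndonWord_iff_append] at hu hv ⊢
  have huv : u ++ v < v := by
    rcases List.prefix_or_append_lt_append h with ⟨t, rfl⟩ | h'
    · rw [List.append_lt_append_left_iff]
      refine hv.2 u t hu.1 ?_ rfl
      rintro rfl
      simp at h
    · simpa using h' v []
  refine ⟨by simp [hu.1], fun p q hp hq hpq => ?_⟩
  rcases List.append_eq_append_iff.1 hpq with ⟨a, rfl, rfl⟩ | ⟨a, rfl, rfl⟩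
  · rcases eq_or_ne a [] with rfl | ha
    · simpa using huv
    · exact List.append_lt_append_of_lt (hu.2 p a hp ha rfl) (by simp) _ _
  · rcases eq_or_ne a [] with rfl | ha
    · simpa using huv
    · exact huv.trans (hv.2 a q ha hq rfl)

/-- A word that is not Lyndon has a proper nonempty suffix no larger than itself; descend on the
length. -/
theorem exists_isLyndonWord_suffix_le {w : List I} (hw : w ≠ []) :
    ∃ u v : List I, u ++ v = w ∧ IsLyndonWord v ∧ v ≤ w := by
  induction hn : w.length using Nat.strong_induction_on generalizing w with
  | _ n ih =>
    by_cases hL : IsLyndonWord w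
    · exact ⟨[], w, rfl, hL, le_rfl⟩
    · rw [isLyndonWord_iff_append] at hL
      push Not at hL
      obtain ⟨p, q, hp, hq, rfl, hle⟩ := hL hw
      obtain ⟨u, v, rfl, hv, hvq⟩ := ih q.length
        (by rw [← hn, List.length_append]; have := List.length_pos_iff.2 hp; omega) hq rfl
      exact ⟨p ++ u, v, by simp, hv, hvq.trans hle⟩

/-! ### The costandard factorization. -/

section Costandard

variable {i j : I} {w : List I}

theorem isLyndonWord_drop_costandardIndex (i j : I) (w : List I) :
    IsLyndonWord ((i :: j :: w).drop (costandardIndex i j w)) := by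
  classical
  exact (Nat.find_spec (exists_lyndon_suffix i j w)).2

theorem costandardIndex_le {n : ℕ} (h0 : 0 < n) (hn : IsLyndonWord ((i :: j :: w).drop n)) :
    costandardIndex i j w ≤ n := by
  classical
  exact Nat.find_min' (exists_lyndon_suffix i j w) ⟨h0, hn⟩

/-- The right factor of the costandard factorization is the smallest proper suffix. -/
theorem drop_costandardIndex_le {p q : List I} (hp : p ≠ []) (hq : q ≠ [])
    (h : p ++ q = i :: j :: w) : (i :: j :: w).drop (costandardIndex i j w) ≤ q := by
  obtain ⟨u, v, rfl, hv, hvq⟩ := exists_isLyndonWord_suffix_le hq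
  refine le_trans ?_ hvq
  have hdrop : (i :: j :: w).drop (p ++ u).length = v := by
    rw [← h, ← List.append_assoc, List.drop_left]
  have hle : costandardIndex i j w ≤ (p ++ u).length :=
    costandardIndex_le (List.length_pos_iff.2 (by simp [hp])) (by rwa [hdrop])
  -- The Lyndon suffix `v` is no longer than the right factor, hence a suffix of it, and a Lyndon
  -- word is at most each of its nonempty suffixes.
  rcases hle.lt_or_eq with hlt | heq
  · have hL := (isLyndonWord_drop_costandardIndex i j w).2
      ((p ++ u).length - costandardIndex i j w) (by omega) (by
        have := congrArg List.length h
        have hv' := List.length_pos_iff.2 hv.1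
        simp only [List.length_append, List.length_drop] at this hlt ⊢
        omega)
    rw [List.drop_drop, Nat.add_sub_cancel' hle, hdrop] at hL
    exact hL.le
  · rw [heq, hdrop]

/-- The left factor of the costandard factorization of a Lyndon word is Lyndon. -/
theorem isLyndonWord_take_costandardIndex (hw : IsLyndonWord (i :: j :: w)) :
    IsLyndonWord ((i :: j :: w).take (costandardIndex i j w)) := by
  rw [isLyndonWord_iff_append] at hw ⊢
  have hpos := costandardIndex_pos i j w
  have hmin := @drop_costandardIndex_le I _ i j w
  have hdec := List.take_append_drop (costandardIndex i j w) (i :: j :: w)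
  have hv0 := (isLyndonWord_drop_costandardIndex i j w).1
  refine ⟨by simp; omega, fun p q hp hq hpq => ?_⟩
  generalize (i :: j :: w).take (costandardIndex i j w) = u at *
  generalize (i :: j :: w).drop (costandardIndex i j w) = v at *
  subst hpq
  by_contra hlt
  have hlt : q < p ++ q := by
    refine lt_of_le_of_ne (not_lt.1 hlt) fun h => hp ?_
    simpa using congrArg List.length h
  have hw2 := hw.2 p (q ++ v) hp (by simp [hq]) (by rw [← hdec, List.append_assoc])
  -- If `q` is a prefix of the left factor `p ++ q = q ++ x`, cancelling `q` in `hw2` leaves `x ++ v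
  -- < v`, although `v` is the smallest proper suffix. Otherwise `q ++ v` is already smaller than
  -- the whole word, against `hw2`.
  rcases List.prefix_or_append_lt_append hlt with ⟨x, hx⟩ | h
  · rw [← hdec, ← hx, List.append_assoc, List.append_lt_append_left_iff] at hw2
    refine absurd hw2 (not_lt.2 (hmin hq (by simp [hv0]) ?_))
    rw [← hdec, ← hx, List.append_assoc]
  · rw [← hdec] at hw2
    exact lt_asymm hw2 (h v v)

end Costandard

/-- Every nonempty suffix `u'` of `u` satisfies `v ≤ u' v`. -/
def LeSuffixesAppend (v : List I) : List I → Prop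
  | [] => True
  | a :: u => v ≤ a :: u ++ v ∧ LeSuffixesAppend v u

theorem LeSuffixesAppend.le_drop {v u : List I} (h : LeSuffixesAppend v u) {n : ℕ}
    (hn : n < u.length) : v ≤ u.drop n ++ v := by
  induction u generalizing n with
  | nil => simp at hn
  | cons a u ih =>
    cases n with
    | zero => exact h.1
    | succ n => exact ih h.2 (by simpa using hn)

variable {L : Type*} [LieRing L]

/-- A criterion for `u v` to be the costandard factorization. -/
theorem stdBracketing_append (e : I → L) {u v : List I} (hu : u ≠ []) (hv : IsLyndonWord v)
    (h : LeSuffixesAppend v u.tail) :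
    stdBracketing e (u ++ v) = ⁅stdBracketing e u, stdBracketing e v⁆ := by
  classical
  obtain ⟨i, u, rfl⟩ := List.exists_cons_of_ne_nil hu
  obtain ⟨j, w, hj⟩ := List.exists_cons_of_ne_nil (show u ++ v ≠ [] by simp [hv.1])
  have hw : i :: u ++ v = i :: j :: w := by simp [hj]
  have hidx : costandardIndex i j w = (i :: u).length := by
    refine (Nat.find_eq_iff _).2 ⟨⟨by simp, by rw [← hw, List.drop_left]; exact hv⟩, ?_⟩
    -- A longer Lyndon proper suffix would have the form `u' ++ v` with `u'` a nonempty suffix of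
    -- `u.tail`, and would satisfy `u' ++ v < v`, contrary to `h`.
    rintro n hn ⟨h0, hL⟩
    obtain ⟨n, rfl⟩ : ∃ m, n = m + 1 := ⟨n - 1, by omega⟩
    have hn : n < u.length := by simpa using hn
    rw [List.drop_succ_cons, ← hj, List.drop_append_of_le_length hn.le,
      isLyndonWord_iff_append] at hL
    refine absurd (hL.2 (u.drop n) v ?_ hv.1 rfl) (not_lt.2 (h.le_drop hn))
    exact List.length_pos_iff.1 (by rw [List.length_drop]; omega)
  rw [hw, stdBracketing, hidx, ← hw, List.take_left, List.drop_left]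

theorem stdBracketing_singleton (e : I → L) (i : I) : stdBracketing e [i] = e i := by
  rw [stdBracketing]

/-- The factorization depends on the word alone. This transfers bracketings from the positive
subalgebra to the whole affine algebra. -/
theorem map_stdBracketing {L' : Type*} [LieRing L'] (e : I → L) (f : L →+ L')
    (hf : ∀ x y, f ⁅x, y⁆ = ⁅f x, f y⁆) (w : List I) :
    f (stdBracketing e w) = stdBracketing (fun i => f (e i)) w := by
  induction hn : w.length using Nat.strong_induction_on generalizing w with
  | _ n ih =>
    match w with
    | [] => simp [stdBracketing]
    | [i] => simp [stdBracketing]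
    | i :: j :: w =>
      have h0 := costandardIndex_pos i j w
      have h1 := costandardIndex_lt i j w
      rw [stdBracketing, hf, ih _ _ _ rfl, ih _ _ _ rfl, ← stdBracketing] <;>
      · simp only [List.length_take, List.length_drop, ← hn]
        simp only [List.length_cons] at h1 ⊢
        omega

end WordLemmas

/-! ### The loop elements -/

theorem loopElem_add (x y : SL3) (n : ℤ) : loopElem (x + y) n = loopElem x n + loopElem y n := by
  simp [loopElem, TensorProduct.tmul_add, ← LieAlgebra.of_add]

theorem loopElem_smul (c : ℂ) (x : SL3) (n : ℤ) : loopElem (c • x) n = c • loopElem x n := by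
  simp [loopElem, TensorProduct.tmul_smul, ← LieAlgebra.of_smul]

theorem loopElem_zero (n : ℤ) : loopElem 0 n = 0 := by
  simpa using loopElem_smul 0 0 n

theorem toFinsupp_loopElem (x : SL3) (n : ℤ) :
    LieAlgebra.LoopAlgebra.toFinsupp ℂ ℤ SL3
      ((LieAlgebra.ofProd affineSL3Cocycle).symm (loopElem x n)).1 = Finsupp.single n x :=
  LieAlgebra.LoopAlgebra.toFinsupp_single_tmul ℂ ℤ SL3 n x

/-- In nonnegative degrees the cocycle vanishes. -/
theorem loopElem_lie (x y : SL3) (n m : ℕ) :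
    ⁅loopElem x n, loopElem y m⁆ = loopElem ⁅x, y⁆ ((n + m : ℕ) : ℤ) := by
  have h : LieAlgebra.LoopAlgebra.residuePairing ℂ ℤ SL3 (-sl3Pairing)
      ((LieAlgebra.ofProd affineSL3Cocycle).symm (loopElem x n)).1
      ((LieAlgebra.ofProd affineSL3Cocycle).symm (loopElem y m)).1 = 0 := by
    rw [LieAlgebra.LoopAlgebra.residuePairing_apply_apply, toFinsupp_loopElem, toFinsupp_loopElem,
      Finsupp.sum_single_index (by simp)]
    rcases Nat.eq_zero_or_pos m with rfl | hm
    · simp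
    · rw [Finsupp.single_eq_of_ne (by omega)]
      simp
  rw [LieAlgebra.bracket_ofTwoCocycle]
  refine congrArg _ (Prod.ext ?_ ?_)
  · change ⁅AddMonoidAlgebra.single (n : ℤ) (1 : ℂ) ⊗ₜ[ℂ] x,
      AddMonoidAlgebra.single (m : ℤ) (1 : ℂ) ⊗ₜ[ℂ] y⁆ =
      AddMonoidAlgebra.single ((n + m : ℕ) : ℤ) (1 : ℂ) ⊗ₜ[ℂ] ⁅x, y⁆
    rw [LieAlgebra.ExtendScalars.bracket_tmul, AddMonoidAlgebra.single_mul_single, mul_one,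
      Nat.cast_add]
  · simp [h, trivial_lie_zero]

/-- The `(a, b)` entry of the coefficient of `tⁿ`. -/
noncomputable def loopEntry (n : ℤ) (a b : Fin 3) : AffineSL3 →ₗ[ℂ] ℂ where
  toFun z := (LieAlgebra.LoopAlgebra.toFinsupp ℂ ℤ SL3
    ((LieAlgebra.ofProd affineSL3Cocycle).symm z).1 n).val a b
  map_add' x y := by simp
  map_smul' c x := by simp

theorem loopEntry_loopElem (n m : ℤ) (a b : Fin 3) (x : SL3) :
    loopEntry n a b (loopElem x m) = if m = n then x.val a b else 0 := by
  change (LieAlgebra.LoopAlgebra.toFinsupp ℂ ℤ SL3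
    ((LieAlgebra.ofProd affineSL3Cocycle).symm (loopElem x m)).1 n).val a b = _
  rw [toFinsupp_loopElem]
  by_cases h : m = n
  · simp [h]
  · simp [h, Finsupp.single_eq_of_ne (Ne.symm h)]

/-! ### Root types -/

/-- The types of positive roots with multiplicity: the names list the simple roots occurring in the
finite part, `im1` and `im2` stand for the two words in an imaginary degree. -/
inductive RootType : Type
  | a1 | a2 | a0 | a12 | a10 | a20 | im1 | im2
  deriving DecidableEq

namespace RootType

/-- The matrix positions at which the elements of a given type may be nonzero. -/
def support : RootType → Fin 3 → Fin 3 → Bool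
  | a1, 0, 1 => true
  | a2, 1, 2 => true
  | a0, 2, 0 => true
  | a12, 0, 2 => true
  | a10, 2, 1 => true
  | a20, 1, 0 => true
  | im1, 1, 1 => true
  | im1, 2, 2 => true
  | im2, 0, 0 => true
  | im2, 1, 1 => true
  | im2, 2, 2 => true
  | _, _, _ => false

/-- The row of a matrix position that detects a given type. -/
def row : RootType → Fin 3
  | a1 => 0 | a2 => 1 | a0 => 2 | a12 => 0 | a10 => 2 | a20 => 1 | im1 => 1 | im2 => 0

/-- The column of a matrix position that detects a given type. -/
def col : RootType → Fin 3
  | a1 => 1 | a2 => 2 | a0 => 0 | a12 => 2 | a10 => 1 | a20 => 0 | im1 => 1 | im2 => 0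

/-- The multiplicity of a simple root in the smallest root of a given type. -/
def coeff : RootType → AffineLetter → ℕ
  | a1, .l1 => 1
  | a2, .l2 => 1
  | a0, .l0 => 1
  | a12, .l1 => 1
  | a12, .l2 => 1
  | a10, .l1 => 1
  | a10, .l0 => 1
  | a20, .l2 => 1
  | a20, .l0 => 1
  | im1, _ => 1
  | im2, _ => 1
  | _, _ => 0

/-- The type of the bracket of elements of two types, and its multiple of `δ`. -/
def sum : RootType → RootType → Option (RootType × ℕ)
  | a10, a2 => some (im1, 0)
  | a12, a0 => some (im2, 0)
  | a1, a20 => some (im2, 0)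
  | a1, a2 => some (a12, 0)
  | a1, a0 => some (a10, 0)
  | a2, a0 => some (a20, 0)
  | a12, a10 => some (a1, 1)
  | a12, a20 => some (a2, 1)
  | a10, a20 => some (a0, 1)
  | a1, im1 => some (a1, 1)
  | a1, im2 => some (a1, 1)
  | im1, a2 => some (a2, 1)
  | im2, a2 => some (a2, 1)
  | im1, a0 => some (a0, 1)
  | im2, a0 => some (a0, 1)
  | a12, im1 => some (a12, 1)
  | a12, im2 => some (a12, 1)
  | a10, im1 => some (a10, 1)
  | im2, a10 => some (a10, 1)
  | im1, a20 => some (a20, 1)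
  | im2, a20 => some (a20, 1)
  | _, _ => none

theorem sum_coeff {i j m : RootType} {d : ℕ} (h : sum i j = some (m, d)) (l : AffineLetter) :
    i.coeff l + j.coeff l = d + m.coeff l := by
  cases i <;> cases j <;> simp [sum] at h <;> obtain ⟨rfl, rfl⟩ := h <;> cases l <;> rfl

/-- The matrices of a given type. -/
def Mem (i : RootType) (x : SL3) : Prop :=
  ∀ a b, i.support a b = false → x.val a b = 0

/-- The matrices of a given type that are nonzero at the detecting position. -/
def MemGen (i : RootType) (x : SL3) : Prop :=
  i.Mem x ∧ x.val i.row i.col ≠ 0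

theorem sl3_lie_apply (x y : SL3) (a b : Fin 3) :
    (⁅x, y⁆ : SL3).val a b =
      ∑ c, (x.val a c * y.val c b - y.val a c * x.val c b) := by
  rw [LieAlgebra.SpecialLinear.sl_bracket, Matrix.sub_apply, Matrix.mul_apply, Matrix.mul_apply,
    Finset.sum_sub_distrib]

theorem sl3_trace (x : SL3) : x.val 0 0 + x.val 1 1 + x.val 2 2 = 0 := by
  have h : Matrix.trace x.val = 0 := x.property
  rwa [Matrix.trace_fin_three] at h

theorem support_sum {i j m : RootType} {d : ℕ} (h : sum i j = some (m, d)) (a b c : Fin 3)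
    (hm : m.support a b = false) :
    (i.support a c = false ∨ j.support c b = false) ∧
      (j.support a c = false ∨ i.support c b = false) := by
  cases i <;> cases j <;> simp [sum] at h <;> obtain ⟨rfl, rfl⟩ := h <;>
    revert a b c <;> decide

theorem Mem.lie {i j m : RootType} {d : ℕ} (h : sum i j = some (m, d)) {x y : SL3}
    (hx : i.Mem x) (hy : j.Mem y) : m.Mem ⁅x, y⁆ := by
  intro a b hab
  rw [sl3_lie_apply]
  refine Finset.sum_eq_zero fun c _ => ?_
  obtain ⟨h1, h2⟩ := support_sum h a b c hab
  have e1 : x.val a c * y.val c b = 0 :=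
    h1.elim (fun h => by rw [hx _ _ h, zero_mul]) (fun h => by rw [hy _ _ h, mul_zero])
  have e2 : y.val a c * x.val c b = 0 :=
    h2.elim (fun h => by rw [hy _ _ h, zero_mul]) (fun h => by rw [hx _ _ h, mul_zero])
  rw [e1, e2, sub_zero]

/-- The imaginary types. -/
def IsImag (i : RootType) : Prop := i = im1 ∨ i = im2

instance (i : RootType) : Decidable i.IsImag := inferInstanceAs (Decidable (_ ∨ _))

theorem Mem.im2_of_isImag {i : RootType} (hi : i.IsImag) {x : SL3} (hx : i.Mem x) :
    im2.Mem x := by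
  intro a b h
  refine hx a b ?_
  rcases hi with rfl | rfl <;> revert a b <;> decide

theorem support_of_sum_eq_none {i j : RootType} (h : sum i j = none) (h' : sum j i = none)
    (hij : ¬ (i.IsImag ∧ j.IsImag)) (a b c : Fin 3) :
    (i.support a c = false ∨ j.support c b = false) ∧
      (j.support a c = false ∨ i.support c b = false) := by
  revert a b c
  cases i <;> cases j <;> first
    | (simp [sum] at h; done)
    | (simp [sum] at h'; done)
    | exact absurd (by decide) hij
    | decide

/-- Two imaginary types consist of diagonal matrices, which commute. For any other pair without a
sum, the supports are such that both matrix products vanish. -/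
theorem Mem.lie_eq_zero {i j : RootType} (h : sum i j = none) (h' : sum j i = none) {x y : SL3}
    (hx : i.Mem x) (hy : j.Mem y) : ⁅x, y⁆ = 0 := by
  refine Subtype.ext (Matrix.ext fun a b => ?_)
  rw [sl3_lie_apply]
  change _ = (0 : ℂ)
  by_cases hij : i.IsImag ∧ j.IsImag
  · have hx := hx.im2_of_isImag hij.1
    have hy := hy.im2_of_isImag hij.2
    refine Finset.sum_eq_zero fun c _ => ?_
    have hs : ∀ a b, a ≠ b → im2.support a b = false := by decide
    by_cases hac : a = c
    · by_cases hcb : c = b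
      · subst hac hcb; ring
      · rw [hx _ _ (hs c b hcb), hy _ _ (hs c b hcb)]; ring
    · rw [hx _ _ (hs a c hac), hy _ _ (hs a c hac)]; ring
  · refine Finset.sum_eq_zero fun c _ => ?_
    obtain ⟨h1, h2⟩ := support_of_sum_eq_none h h' hij a b c
    have e1 : x.val a c * y.val c b = 0 :=
      h1.elim (fun h => by rw [hx _ _ h, zero_mul]) (fun h => by rw [hy _ _ h, mul_zero])
    have e2 : y.val a c * x.val c b = 0 :=
      h2.elim (fun h => by rw [hy _ _ h, zero_mul]) (fun h => by rw [hx _ _ h, mul_zero])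
    rw [e1, e2, sub_zero]

/-- Every type except `im2` is a line: a single matrix unit, or diag(0, a, -a) for `im1`, where
tracelessness fixes the last entry. -/
theorem Mem.eq_smul {i : RootType} (hi : i ≠ im2) {x y : SL3} (hx : i.Mem x) (hy : i.MemGen y) :
    x = (x.val i.row i.col / y.val i.row i.col) • y := by
  refine Subtype.ext (Matrix.ext fun a b => ?_)
  change _ = (x.val i.row i.col / y.val i.row i.col) * y.val a b
  obtain ⟨hy, hy0⟩ := hy
  by_cases hab : i.support a b = false
  · rw [hx a b hab, hy a b hab, mul_zero]
  · have hpos : (a = i.row ∧ b = i.col) ∨ (i = im1 ∧ a = 2 ∧ b = 2) := by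
      clear hx hy hy0
      revert a b
      cases i <;> first | exact absurd rfl hi | decide
    rcases hpos with ⟨rfl, rfl⟩ | ⟨rfl, rfl, rfl⟩
    · field_simp
    · have h1 := sl3_trace x
      have h2 := sl3_trace y
      rw [hx 0 0 rfl] at h1
      rw [hy 0 0 rfl] at h2
      simp only [row, col] at hy0 ⊢
      field_simp
      linear_combination y.val 1 1 * h1 - x.val 1 1 * h2

/-- Clearing the (0, 0) entry of a diagonal matrix lands in `im1`, so a generic element of `im2` and
one of `im1` span the Cartan subalgebra. -/
theorem Mem.im1_sub {x y : SL3} (hx : im2.Mem x) (hy : im2.MemGen y) :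
    im1.Mem (x - (x.val 0 0 / y.val 0 0) • y) := by
  intro a b hab
  change x.val a b - (x.val 0 0 / y.val 0 0) * y.val a b = 0
  obtain ⟨hy, hy0⟩ := hy
  simp only [row, col] at hy0
  by_cases h0 : im2.support a b = false
  · rw [hx a b h0, hy a b h0]; ring
  · obtain ⟨rfl, rfl⟩ : a = 0 ∧ b = 0 := by
      clear hx hy hy0
      revert a b
      decide
    field_simp
    ring

/-- The pairs of types whose brackets are used to compute the standard bracketings. -/
theorem MemGen.lie {i j m : RootType} {d : ℕ} (h : sum i j = some (m, d))
    (hij : i ≠ im2 ∧ j ≠ im2) {x y : SL3}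
    (hx : i.MemGen x) (hy : j.MemGen y) : m.MemGen ⁅x, y⁆ := by
  refine ⟨hx.1.lie h hy.1, ?_⟩
  have tx := sl3_trace x
  have ty := sl3_trace y
  obtain ⟨hx, hx0⟩ := hx
  obtain ⟨hy, hy0⟩ := hy
  rw [sl3_lie_apply, Fin.sum_univ_three]
  unfold Mem at hx hy
  -- Type `im2` must be excluded as a factor: diag(-2, 1, 1) is generic of that type but commutes
  -- with `E₂₃`. For `im1`, the trace relations turn the action of diag(0, a, -a) into a nonzero
  -- multiple of `a`.
  cases i <;> cases j <;> simp [sum] at h hij <;> obtain ⟨rfl, rfl⟩ := h <;>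
    simp [support, row, col, hx, hy] at hx0 hy0 tx ty ⊢ <;> grind
end RootType

/-! ### The words -/

namespace AffineLetter

@[simp] theorem l1_lt_l2 : l1 < l2 := by decide
@[simp] theorem l1_lt_l0 : l1 < l0 := by decide
@[simp] theorem l2_lt_l0 : l2 < l0 := by decide
@[simp] theorem not_l2_lt_l1 : ¬ l2 < l1 := by decide
@[simp] theorem not_l0_lt_l1 : ¬ l0 < l1 := by decide
@[simp] theorem not_l0_lt_l2 : ¬ l0 < l2 := by decide

end AffineLetter

open AffineLetter

@[simp] theorem rep102_zero : rep102 0 = [] := rfl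

@[simp] theorem rep102_succ (k : ℕ) : rep102 (k + 1) = l1 :: l0 :: l2 :: rep102 k := by
  simp [rep102, List.replicate_succ]

theorem rep102_add (k m : ℕ) : rep102 (k + m) = rep102 k ++ rep102 m := by
  rw [rep102, List.replicate_add, List.flatten_append]; rfl

theorem rep102_succ' (k : ℕ) : rep102 (k + 1) = rep102 k ++ [l1, l0, l2] := by
  rw [rep102_add]; simp

namespace RootType

/-- The words of the theorem, by type and multiple of `δ`. -/
def word : RootType → ℕ → List AffineLetter
  | a1, 0 => [l1]
  | a1, k + 1 => [l1, l2] ++ rep102 k ++ [l1, l0]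
  | a2, k => rep102 k ++ [l2]
  | a0, k => rep102 k ++ [l0]
  | a12, k => [l1, l2] ++ rep102 k
  | a10, k => [l1, l0] ++ rep102 k
  | a20, k =>
    if Even k then rep102 (k / 2) ++ [l2] ++ rep102 (k / 2) ++ [l0]
    else rep102 ((k + 1) / 2) ++ [l0] ++ rep102 ((k - 1) / 2) ++ [l2]
  | im1, k => [l1, l0] ++ rep102 k ++ [l2]
  | im2, k => [l1, l2] ++ rep102 k ++ [l0]

theorem word_a20_even (m : ℕ) : word a20 (m + m) = word a2 m ++ word a0 m := by
  have h : (m + m) / 2 = m := by omega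
  simp [word, h]

theorem word_a20_odd (m : ℕ) : word a20 (m + m + 1) = word a0 (m + 1) ++ word a2 m := by
  have h : (m + m + 1 + 1) / 2 = m + 1 := by omega
  have h' : (m + m) / 2 = m := by omega
  have h'' : ¬ Even (m + m + 1) := by simp [parity_simps]
  simp only [word, if_neg h'', h, Nat.add_sub_cancel, h', List.append_assoc]

/-- The words of type `a20` begin with `102`, except for the word `20`. -/
theorem exists_word_a20_succ (k : ℕ) : ∃ v, word a20 (k + 1) = [l1, l0, l2] ++ v := by
  rcases Nat.even_or_odd' (k + 1) with ⟨m, h | h⟩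
  · obtain ⟨n, rfl⟩ : ∃ n, m = n + 1 := ⟨m - 1, by omega⟩
    rw [h, two_mul, word_a20_even]
    exact ⟨_, by simp [word]; rfl⟩
  · rw [h, two_mul, word_a20_odd]
    exact ⟨_, by simp [word]; rfl⟩

theorem wordDegree_apply (w : List AffineLetter) (l : AffineLetter) :
    wordDegree w l = w.count l := by
  induction w with
  | nil => rfl
  | cons a w ih =>
    have : wordDegree (a :: w) = simpleRoot a + wordDegree w := by simp [wordDegree]
    rw [this, Pi.add_apply, ih, List.count_cons, simpleRoot, Pi.single_apply, add_comm]
    by_cases h : l = a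
    · simp [h]
    · simp [h, Ne.symm h]

theorem count_rep102 (k : ℕ) (l : AffineLetter) : (rep102 k).count l = k := by
  induction k with
  | zero => rfl
  | succ k ih => cases l <;> simp [ih]

theorem wordDegree_word (i : RootType) (k : ℕ) (l : AffineLetter) :
    wordDegree (i.word k) l = k + i.coeff l := by
  rw [wordDegree_apply]
  by_cases hi : i = a20
  · subst hi
    rcases Nat.even_or_odd' k with ⟨m, rfl | rfl⟩
    · rw [two_mul, word_a20_even]
      cases l <;> simp [word, count_rep102, coeff] <;> omega
    · rw [two_mul, word_a20_odd]
      cases l <;> simp [word, count_rep102, coeff] <;> omega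
  · cases i <;> first
      | exact absurd rfl hi
      | (cases k <;> cases l <;> simp [word, count_rep102, coeff])

theorem length_eq_of_wordDegree_eq {u v : List AffineLetter} (h : wordDegree u = wordDegree v) :
    u.length = v.length := by
  refine List.Perm.length_eq (List.perm_iff_count.2 fun l => ?_)
  rw [← wordDegree_apply, ← wordDegree_apply, h]

/-- Equal degrees, up to the two words in an imaginary degree. -/
theorem eq_of_wordDegree_eq {i j : RootType} {k m : ℕ}
    (h : wordDegree (i.word k) = wordDegree (j.word m)) :
    k = m ∧ (i = j ∨ (i.IsImag ∧ j.IsImag)) := by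
  have h1 := congrFun h l1
  have h2 := congrFun h l2
  have h0 := congrFun h l0
  simp only [wordDegree_word] at h1 h2 h0
  cases i <;> cases j <;> simp only [coeff] at h1 h2 h0 <;>
    first | (exfalso; omega) | exact ⟨by omega, by simp [IsImag]⟩

/-- After the common blocks are cancelled, the longer power continues with the smallest letter 1. -/
theorem rep102_append_lt {j m : ℕ} (h : j < m) (x y : List AffineLetter) {a : AffineLetter}
    (ha : l1 < a) : rep102 m ++ x < rep102 j ++ a :: y := by
  obtain ⟨d, rfl⟩ : ∃ d, m = j + (d + 1) := ⟨m - j - 1, by omega⟩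
  rw [rep102_add, List.append_assoc, List.append_lt_append_left_iff]
  simp [List.cons_lt_cons_iff_of_linearOrder, ha]

/-- The combinatorial core: no decomposition of a degree into two types yields two concatenations
that both exceed the listed word. The argument order in `sum` is chosen so that the first
concatenation suffices, except for `a2` and `a0`. There the smaller concatenation starts with the
larger power of 102, so it is largest when the exponents are balanced, which produces the parity
cases of `a20`. -/
theorem word_sum_le {i j m : RootType} {d : ℕ} (h : sum i j = some (m, d)) (k n : ℕ) :
    i.word k ++ j.word n ≤ m.word (k + n + d) ∨ j.word n ++ i.word k ≤ m.word (k + n + d) := by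
  by_cases h1 : i = a2 ∧ j = a0
  · obtain ⟨rfl, rfl⟩ := h1
    obtain ⟨rfl, rfl⟩ : a20 = m ∧ 0 = d := by simpa [sum] using h
    rw [add_zero]
    rcases Nat.even_or_odd' (k + n) with ⟨r, h | h⟩
    · rw [h, two_mul, word_a20_even]
      rcases lt_trichotomy r k with hr | rfl | hr
      · left
        simpa [word] using (rep102_append_lt hr ([l2] ++ word a0 n) (word a0 r) l1_lt_l2).le
      · obtain rfl : n = r := by omega
        exact Or.inl le_rfl
      · right
        have hr : r < n := by omega
        simpa [word] using (rep102_append_lt hr ([l0] ++ word a2 k) (word a0 r) l1_lt_l2).le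
    · rw [h, two_mul, word_a20_odd]
      rcases lt_trichotomy (r + 1) n with hr | rfl | hr
      · right
        simpa [word] using
          (rep102_append_lt hr ([l0] ++ word a2 k) (word a2 r) l1_lt_l0).le
      · obtain rfl : k = r := by omega
        exact Or.inr le_rfl
      · left
        rcases Nat.lt_or_ge (r + 1) k with hr | hr'
        · simpa [word] using
            (rep102_append_lt hr ([l2] ++ word a0 n) (word a2 r) l1_lt_l0).le
        · obtain rfl : k = r + 1 := by omega
          simp [word, List.cons_le_cons_iff_of_linearOrder, List.append_le_append_left_iff]
  left
  by_cases h2 : m = a20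
  · subst h2
    obtain ⟨v, hv⟩ := exists_word_a20_succ (k + n)
    cases i <;> cases j <;> simp [sum] at h h1 <;> subst h <;> rw [hv]
    · rcases k with _ | k
      · rw [zero_add] at hv
        rw [← hv]
        rcases Nat.even_or_odd' n with ⟨r, rfl | rfl⟩
        · rw [two_mul, word_a20_even, word_a20_odd]
          simp [word, List.cons_le_cons_iff_of_linearOrder, List.append_le_append_left_iff]
        · rw [two_mul, word_a20_odd, show r + r + 1 + 1 = (r + 1) + (r + 1) by omega,
            word_a20_even, ← List.append_assoc, word, word, word, word]
          simpa [word] using (rep102_append_lt (Nat.lt_succ_self (r + 1)) ([l0] ++ word a2 r)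
            (word a0 (r + 1)) l1_lt_l2).le
      · simp [word, List.cons_le_cons_iff_of_linearOrder]
    · simp [word, List.cons_le_cons_iff_of_linearOrder]
  have r1 (k n : ℕ) : rep102 (k + n + 1) = rep102 k ++ l1 :: l0 :: l2 :: rep102 n := by
    rw [add_assoc, rep102_add, rep102_succ]
  have r2 (k n : ℕ) : rep102 (k + 1 + n) = rep102 k ++ l1 :: l0 :: l2 :: rep102 n := by
    rw [add_right_comm, r1]
  by_cases h3 : j = a20
  · subst h3
    obtain ⟨v, hv⟩ := exists_word_a20_succ (n - 1)
    by_cases h4 : i = a1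
    · subst h4
      obtain ⟨rfl, rfl⟩ : im2 = m ∧ 0 = d := by simpa [sum] using h
      rcases n with _ | n
      · rcases k with _ | k <;>
          simp [word, rep102_succ', -rep102_succ]
      · rw [Nat.add_sub_cancel] at hv
        rw [hv]
        rcases k with _ | k <;> simp only [word, r2, add_zero] <;>
          simp [List.cons_le_cons_iff_of_linearOrder, List.append_le_append_left_iff]
    · rcases n with _ | n
      · cases i <;> simp [sum] at h h4 <;> obtain ⟨rfl, rfl⟩ := h <;> rcases k with _ | k <;>
          simp [word, List.cons_le_cons_iff_of_linearOrder] at h2 ⊢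
      · rw [Nat.add_sub_cancel] at hv
        cases i <;> simp [sum] at h h4 <;> obtain ⟨rfl, rfl⟩ := h <;> rcases k with _ | k <;>
          rw [hv] <;> simp [word, List.cons_le_cons_iff_of_linearOrder] at h2 ⊢
  by_cases h4 : i = a1
  · subst h4
    rcases k with _ | k
    · cases j <;> simp [sum] at h h3 <;> obtain ⟨rfl, rfl⟩ := h <;> rcases n with _ | n <;>
        simp [word, List.cons_le_cons_iff_of_linearOrder]
    · cases j <;> simp [sum] at h h3 <;> obtain ⟨rfl, rfl⟩ := h <;>
        simp only [word, r2, add_zero] <;> rcases n with _ | n <;>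
        simp [List.cons_le_cons_iff_of_linearOrder, List.append_le_append_left_iff]
  by_cases h5 : i.IsImag
  · rcases h5 with rfl | rfl <;> cases j <;> simp [sum] at h h3 <;> obtain ⟨rfl, rfl⟩ := h <;>
      simp only [word, r1] <;> rcases k with _ | k <;>
      simp [List.cons_le_cons_iff_of_linearOrder]
  · cases i <;> cases j <;> simp [sum] at h h1 h3 h4 <;> simp [IsImag] at h5 <;>
      obtain ⟨rfl, rfl⟩ := h <;>
      simp at h2 <;> simp only [word, r1, rep102_add k n, add_zero] <;> rcases n with _ | n <;>
      simp [List.cons_le_cons_iff_of_linearOrder, List.append_le_append_left_iff]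

end RootType

/-! ### Bracketings of the words -/

@[simp] theorem nil_le_word (v : List AffineLetter) : [] ≤ v := List.nil_le_of_linearOrder v

@[simp] theorem nil_lt_append_singleton (v : List AffineLetter) (a : AffineLetter) :
    [] < v ++ [a] := by
  cases v <;> exact List.nil_lt_cons _ _

/-- A suffix that starts inside a block begins with 0 or 2 and so exceeds a word beginning with 1.
Only suffixes starting at block boundaries need a hypothesis. -/
theorem leSuffixesAppend_rep102 {v x : List AffineLetter} (k : ℕ)
    (h : ∀ j, j < k → l1 :: v ≤ rep102 (j + 1) ++ (x ++ l1 :: v))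
    (hx : LeSuffixesAppend (l1 :: v) x) : LeSuffixesAppend (l1 :: v) (rep102 k ++ x) := by
  induction k with
  | zero => simpa using hx
  | succ k ih =>
    rw [rep102_succ]
    refine ⟨by simpa using h k (Nat.lt_succ_self k), ?_, ?_,
      ih fun j hj => h j (hj.trans (Nat.lt_succ_self k))⟩ <;>
    simp [List.cons_le_cons_iff_of_linearOrder]

namespace RootType

theorem MemGen.neg {i : RootType} {x : SL3} (hx : i.MemGen x) : i.MemGen (-x) := by
  refine ⟨fun a b h => ?_, ?_⟩
  · change -x.val a b = 0
    rw [hx.1 a b h, neg_zero]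
  · change -x.val i.row i.col ≠ 0
    exact neg_ne_zero.2 hx.2

/-- `w` is a Lyndon word whose standard bracketing is a generic element of type `i` in the
`k`-th multiple of `δ`. -/
structure IsGenericWord (i : RootType) (k : ℕ) (w : List AffineLetter) : Prop where
  isLyndonWord : IsLyndonWord w
  exists_memGen : ∃ x, i.MemGen x ∧
    stdBracketing affineGenerator w = loopElem x ((k + i.coeff l0 : ℕ) : ℤ)

theorem IsGenericWord.append {i j m : RootType} {d k n : ℕ} {u v : List AffineLetter}
    (hu : i.IsGenericWord k u) (hv : j.IsGenericWord n v)
    (h : sum i j = some (m, d) ∨ sum j i = some (m, d)) (hij : i ≠ im2 ∧ j ≠ im2)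
    (huv : u < v) (hs : LeSuffixesAppend v u.tail) : m.IsGenericWord (k + n + d) (u ++ v) := by
  obtain ⟨hu, x, hx, hbu⟩ := hu
  obtain ⟨hv, y, hy, hbv⟩ := hv
  refine ⟨hu.append hv huv, ⟨⁅x, y⁆, ?_, ?_⟩⟩
  · rcases h with h | h
    · exact hx.lie h hij hy
    · rw [← lie_skew]
      exact (hy.lie h hij.symm hx).neg
  · rw [stdBracketing_append _ hu.1 hv hs, hbu, hbv, loopElem_lie]
    congr 2
    rcases h with h | h
    · have := sum_coeff h l0
      omega
    · have := sum_coeff h l0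
      omega

theorem isGenericWord_l1 : a1.IsGenericWord 0 [l1] := by
  refine ⟨isLyndonWord_singleton _, ⟨_, ⟨?_, ?_⟩, stdBracketing_singleton _ _⟩⟩
  · intro a b; fin_cases a <;> fin_cases b <;> simp [support]
  · simp [row, col]

theorem isGenericWord_l2 : a2.IsGenericWord 0 [l2] := by
  refine ⟨isLyndonWord_singleton _, ⟨_, ⟨?_, ?_⟩, stdBracketing_singleton _ _⟩⟩
  · intro a b; fin_cases a <;> fin_cases b <;> simp [support]
  · simp [row, col]

theorem isGenericWord_l0 : a0.IsGenericWord 0 [l0] := by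
  refine ⟨isLyndonWord_singleton _, ⟨_, ⟨?_, ?_⟩, stdBracketing_singleton _ _⟩⟩
  · intro a b; fin_cases a <;> fin_cases b <;> simp [support]
  · simp [row, col]

theorem isGenericWord_20 : a20.IsGenericWord 0 [l2, l0] :=
  isGenericWord_l2.append isGenericWord_l0 (Or.inl rfl) (by decide) (by decide) trivial

theorem isGenericWord_12 : a12.IsGenericWord 0 [l1, l2] :=
  isGenericWord_l1.append isGenericWord_l2 (Or.inl rfl) (by decide) (by decide) trivial

theorem isGenericWord_10 : a10.IsGenericWord 0 [l1, l0] :=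
  isGenericWord_l1.append isGenericWord_l0 (Or.inl rfl) (by decide) (by decide) trivial

theorem isGenericWord_102 : im1.IsGenericWord 0 [l1, l0, l2] :=
  isGenericWord_10.append isGenericWord_l2 (Or.inl rfl) (by decide) (by decide)
    ⟨by decide, trivial⟩

theorem isGenericWord_a2 (k : ℕ) : a2.IsGenericWord k (word a2 k) := by
  induction k with
  | zero => exact isGenericWord_l2
  | succ k ih =>
    have h := isGenericWord_102.append ih (Or.inl rfl) (by decide)
      (by cases k <;> simp [word, List.cons_lt_cons_iff_of_linearOrder])
      (by cases k <;> simp [word, LeSuffixesAppend, List.cons_le_cons_iff_of_linearOrder])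
    rw [zero_add] at h
    exact h

theorem isGenericWord_a0 (k : ℕ) : a0.IsGenericWord k (word a0 k) := by
  induction k with
  | zero => exact isGenericWord_l0
  | succ k ih =>
    -- The word 1020 factors as 10 · 20, because 20 is Lyndon; from the next power on, the left
    -- factor is 102.
    rcases k with _ | k
    · exact isGenericWord_10.append isGenericWord_20 (Or.inl rfl) (by decide) (by decide)
        ⟨by decide, trivial⟩
    · have h := isGenericWord_102.append ih (Or.inl rfl) (by decide)
        (by simp [word])
        (by simp [word, LeSuffixesAppend, List.cons_le_cons_iff_of_linearOrder])
      rw [zero_add] at h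
      exact h

theorem isGenericWord_a12 (k : ℕ) : a12.IsGenericWord k (word a12 k) := by
  induction k with
  | zero => exact isGenericWord_12
  | succ k ih =>
    have h := ih.append isGenericWord_102 (Or.inl rfl) (by decide)
      (by simp [word, List.cons_lt_cons_iff_of_linearOrder]) (by
        refine ⟨by simp [List.cons_le_cons_iff_of_linearOrder], ?_⟩
        change LeSuffixesAppend _ (rep102 k)
        rw [← List.append_nil (rep102 k)]
        exact leSuffixesAppend_rep102 k
          (by simp [List.cons_le_cons_iff_of_linearOrder]) trivial)
    rw [add_zero] at h
    rw [word, rep102_succ', ← List.append_assoc]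
    exact h

theorem isGenericWord_a10 (k : ℕ) : a10.IsGenericWord k (word a10 k) := by
  induction k with
  | zero => exact isGenericWord_10
  | succ k ih =>
    have h := ih.append isGenericWord_102 (Or.inl rfl) (by decide)
      (by cases k <;> simp [word, List.cons_lt_cons_iff_of_linearOrder]) (by
        refine ⟨by simp [List.cons_le_cons_iff_of_linearOrder], ?_⟩
        change LeSuffixesAppend _ (rep102 k)
        rw [← List.append_nil (rep102 k)]
        exact leSuffixesAppend_rep102 k
          (by simp [List.cons_le_cons_iff_of_linearOrder]) trivial)
    rw [add_zero] at h
    rw [word, rep102_succ', ← List.append_assoc]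
    exact h

theorem isGenericWord_a1 (k : ℕ) : a1.IsGenericWord k (word a1 k) := by
  rcases k with _ | k
  · exact isGenericWord_l1
  · refine (isGenericWord_a12 k).append isGenericWord_10 (Or.inl rfl) (by decide)
      (by simp [word, List.cons_lt_cons_iff_of_linearOrder]) ?_
    refine ⟨by simp [List.cons_le_cons_iff_of_linearOrder], ?_⟩
    change LeSuffixesAppend _ (rep102 k)
    rw [← List.append_nil (rep102 k)]
    exact leSuffixesAppend_rep102 k (by simp [List.cons_le_cons_iff_of_linearOrder]) trivial

theorem isGenericWord_a20 (k : ℕ) : a20.IsGenericWord k (word a20 k) := by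
  rcases Nat.even_or_odd' k with ⟨m, rfl | rfl⟩
  · rw [two_mul, word_a20_even]
    have h := (isGenericWord_a2 m).append (isGenericWord_a0 m) (m := a20) (d := 0)
      (Or.inl rfl) (by decide) ?_ ?_
    · rwa [add_zero] at h
    · simp [word, List.append_lt_append_left_iff, List.cons_lt_cons_iff_of_linearOrder]
    · rcases m with _ | m
      · exact True.intro
      · change LeSuffixesAppend (l1 :: l0 :: l2 :: (rep102 m ++ [l0]))
          (l0 :: l2 :: (rep102 m ++ [l2]))
        refine ⟨?_, ?_, ?_⟩
        · simp [List.cons_le_cons_iff_of_linearOrder]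
        · simp [List.cons_le_cons_iff_of_linearOrder]
        · refine leSuffixesAppend_rep102 m (fun j hj => ?_) ⟨?_, trivial⟩
          · simpa using (rep102_append_lt (Nat.succ_lt_succ hj) [l0]
              (rep102 (m + 1) ++ [l0]) l1_lt_l2).le
          · simp [List.cons_le_cons_iff_of_linearOrder]
  · rw [two_mul, word_a20_odd]
    have h := (isGenericWord_a0 (m + 1)).append (isGenericWord_a2 m) (m := a20) (d := 0)
      (Or.inr rfl) (by decide) ?_ ?_
    · rwa [add_zero, add_right_comm] at h
    · exact rep102_append_lt (Nat.lt_succ_self m) [l0] [] l1_lt_l2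
    · rcases m with _ | m
      · simp [word, LeSuffixesAppend, List.cons_le_cons_iff_of_linearOrder]
      · change LeSuffixesAppend (l1 :: l0 :: l2 :: (rep102 m ++ [l2]))
          (l0 :: l2 :: (rep102 (m + 1) ++ [l0]))
        refine ⟨?_, ?_, ?_⟩
        · simp [List.cons_le_cons_iff_of_linearOrder]
        · simp [List.cons_le_cons_iff_of_linearOrder]
        · refine leSuffixesAppend_rep102 (m + 1) (fun j hj => ?_) ⟨?_, trivial⟩
          · rcases (Nat.succ_le_of_lt hj).lt_or_eq with hj | hj
            · simpa using (rep102_append_lt hj [l2] (rep102 (m + 1) ++ [l2]) l1_lt_l0).le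
            · simp at hj
              subst hj
              simp [List.append_le_append_left_iff, List.cons_le_cons_iff_of_linearOrder]
          · simp [List.cons_le_cons_iff_of_linearOrder]

theorem isGenericWord_im1 (k : ℕ) : im1.IsGenericWord k (word im1 k) := by
  have h := isGenericWord_10.append (isGenericWord_a2 k) (Or.inl rfl) (by decide)
    (by cases k <;> simp [word, List.cons_lt_cons_iff_of_linearOrder])
    ⟨by cases k <;> simp [word, List.cons_le_cons_iff_of_linearOrder], trivial⟩
  rw [zero_add] at h
  simpa [word] using h

theorem isGenericWord_im2 (k : ℕ) : im2.IsGenericWord k (word im2 k) := by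
  -- The word 120 factors as 1 · 20, whereas the longer words split off 12 on the left.
  rcases k with _ | k
  · exact isGenericWord_l1.append isGenericWord_20 (Or.inl rfl) (by decide) (by decide) trivial
  · have h := isGenericWord_12.append (isGenericWord_a0 (k + 1)) (Or.inl rfl) (by decide)
      (by simp [word, List.cons_lt_cons_iff_of_linearOrder])
      ⟨by simp [word, List.cons_le_cons_iff_of_linearOrder], trivial⟩
    rw [zero_add] at h
    simpa [word] using h

theorem isGenericWord_word (i : RootType) (k : ℕ) : i.IsGenericWord k (word i k) := by
  cases i
  · exact isGenericWord_a1 k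
  · exact isGenericWord_a2 k
  · exact isGenericWord_a0 k
  · exact isGenericWord_a12 k
  · exact isGenericWord_a10 k
  · exact isGenericWord_a20 k
  · exact isGenericWord_im1 k
  · exact isGenericWord_im2 k

end RootType

/-! ### The upper bound for Lyndon words with nonzero bracketing. -/

namespace RootType

/-- The standard bracketing of `w` has type `i` in the `k`-th multiple of `δ`, and `w` does not
exceed the word of that type. -/
structure IsBoundedWord (i : RootType) (k : ℕ) (w : List AffineLetter) : Prop where
  wordDegree_eq : wordDegree w = wordDegree (word i k)
  le_word : w ≤ word i k
  exists_mem : ∃ x, i.Mem x ∧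
    stdBracketing affineGenerator w = loopElem x ((k + i.coeff l0 : ℕ) : ℤ)

theorem wordDegree_append (u v : List AffineLetter) :
    wordDegree (u ++ v) = wordDegree u + wordDegree v := by
  simp [wordDegree]

theorem wordDegree_word_append {i j m : RootType} {d : ℕ} (h : sum i j = some (m, d)) (k n : ℕ) :
    wordDegree (word i k) + wordDegree (word j n) = wordDegree (word m (k + n + d)) := by
  ext l
  have := sum_coeff h l
  rw [Pi.add_apply, wordDegree_word, wordDegree_word, wordDegree_word]
  omega

theorem isBoundedWord_word (i : RootType) (k : ℕ) : i.IsBoundedWord k (word i k) := by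
  obtain ⟨x, hx, h⟩ := (isGenericWord_word i k).exists_memGen
  exact ⟨rfl, le_rfl, x, hx.1, h⟩

theorem IsBoundedWord.append {i j m : RootType} {d k n : ℕ} {u v : List AffineLetter}
    (hu : i.IsBoundedWord k u) (hv : j.IsBoundedWord n v)
    (h : sum i j = some (m, d) ∨ sum j i = some (m, d)) (huv : u ++ v < v)
    (hb : stdBracketing affineGenerator (u ++ v) =
      ⁅stdBracketing affineGenerator u, stdBracketing affineGenerator v⁆) :
    m.IsBoundedWord (k + n + d) (u ++ v) := by
  obtain ⟨hdu, hwu, x, hx, hbu⟩ := hu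
  obtain ⟨hdv, hwv, y, hy, hbv⟩ := hv
  have hlu := length_eq_of_wordDegree_eq hdu
  have hlv := length_eq_of_wordDegree_eq hdv
  have h1 : u ++ v ≤ word i k ++ word j n := List.append_le_append_of_le hwu hlu.ge hwv
  -- From `uv < v`, where `v` is no longer than `uv`, follows `uv < vu`; the bounds on the factors
  -- then apply in the swapped order.
  have h2 : u ++ v ≤ word j n ++ word i k := by
    have := (List.append_lt_append_of_lt huv (by simp) [] u).le
    rw [List.append_nil] at this
    exact this.trans (List.append_le_append_of_le hwv hlv.ge hwu)
  refine ⟨?_, ?_, ⁅x, y⁆, ?_, ?_⟩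
  · rw [wordDegree_append, hdu, hdv]
    rcases h with h | h
    · exact wordDegree_word_append h k n
    · rw [add_comm, wordDegree_word_append h, add_comm n]
  · rcases h with h | h
    · exact (word_sum_le h k n).elim h1.trans h2.trans
    · have h3 := word_sum_le h n k
      rw [add_comm n] at h3
      exact h3.elim h2.trans h1.trans
  · rcases h with h | h
    · exact hx.lie h hy
    · rw [← lie_skew]
      intro a b hab
      change -(⁅y, x⁆ : SL3).val a b = 0
      rw [hy.lie h hx a b hab, neg_zero]
  · rw [hb, hbu, hbv, loopElem_lie]
    congr 2
    rcases h with h | h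
    · have := sum_coeff h l0
      omega
    · have := sum_coeff h l0
      omega

/-- The standard bracketing of a Lyndon word vanishes unless the word is at most the word of
its degree. -/
theorem stdBracketing_eq_zero_or_isBoundedWord {w : List AffineLetter} (hw : IsLyndonWord w) :
    stdBracketing affineGenerator w = 0 ∨ ∃ i k, IsBoundedWord i k w := by
  induction hn : w.length using Nat.strong_induction_on generalizing w with
  | _ n ih =>
    match w with
    | [] => exact absurd rfl hw.1
    | [a] =>
      right
      cases a
      · exact ⟨a1, 0, isBoundedWord_word a1 0⟩
      · exact ⟨a2, 0, isBoundedWord_word a2 0⟩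
      · exact ⟨a0, 0, isBoundedWord_word a0 0⟩
    | a :: b :: w =>
      have hpos := costandardIndex_pos a b w
      have hlt := costandardIndex_lt a b w
      have hb := stdBracketing.eq_3 affineGenerator a b w
      have hu := isLyndonWord_take_costandardIndex hw
      have hv := isLyndonWord_drop_costandardIndex a b w
      have hvlt := hw.2 _ hpos hlt
      have hdec := List.take_append_drop (costandardIndex a b w) (a :: b :: w)
      have hlu : ((a :: b :: w).take (costandardIndex a b w)).length < n := by
        rw [List.length_take]; omega
      have hlv : ((a :: b :: w).drop (costandardIndex a b w)).length < n := by
        rw [List.length_drop]; omega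
      generalize (a :: b :: w).take (costandardIndex a b w) = u at *
      generalize (a :: b :: w).drop (costandardIndex a b w) = v at *
      rw [← hdec] at hb hvlt ⊢
      rcases ih _ hlu hu rfl with h0 | ⟨i, k, hik⟩
      · left; rw [hb, h0, zero_lie]
      rcases ih _ hlv hv rfl with h0 | ⟨j, m, hjm⟩
      · left; rw [hb, h0, lie_zero]
      rcases h : sum i j with _ | ⟨r, d⟩
      · rcases h' : sum j i with _ | ⟨r, d⟩
        · left
          obtain ⟨x, hx, hbu⟩ := hik.exists_mem
          obtain ⟨y, hy, hbv⟩ := hjm.exists_mem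
          rw [hb, hbu, hbv, loopElem_lie, hx.lie_eq_zero h h' hy, loopElem_zero]
        · exact Or.inr ⟨r, _, hik.append hjm (Or.inr h') hvlt hb⟩
      · exact Or.inr ⟨r, _, hik.append hjm (Or.inl h) hvlt hb⟩

/-! ### Classification of the standard words. -/

theorem word_im2_lt_word_im1 (k : ℕ) : word im2 k < word im1 k := by
  simp [word, List.cons_lt_cons_iff_of_linearOrder]

/-- The detecting entry together with the power of `t` isolates a type, except that `im2` also meets
the position (1, 1) of `im1`. This exception is harmless, since the words of type `im2` are the
smaller ones. -/
theorem eq_and_power_eq_of_support {i j : RootType} {k m : ℕ}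
    (h : j.support i.row i.col = true)
    (hp : m + j.coeff l0 = k + i.coeff l0) :
    m = k ∧ (j = i ∨ i.IsImag ∧ j = im2) := by
  cases i <;> cases j <;> simp [support, row, col] at h <;> simp [coeff] at hp <;>
    exact ⟨by omega, by simp [IsImag]⟩

/-- The words of the theorem are standard. -/
theorem isStandardLyndonWord_word (i : RootType) (k : ℕ) :
    IsStandardLyndonWord ℂ affineGenerator (word i k) := by
  obtain ⟨hL, x, hx, hb⟩ := isGenericWord_word i k
  refine ⟨hL, fun hmem => ?_⟩
  -- The detecting entry is a linear functional that kills the bracketings of all larger Lyndon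
  -- words, but not that of `word i k`.
  have hle : Submodule.span ℂ {x | ∃ m, IsLyndonWord m ∧ word i k < m ∧
      stdBracketing affineGenerator m = x} ≤
      LinearMap.ker (loopEntry ((k + i.coeff l0 : ℕ) : ℤ) i.row i.col) := by
    rw [Submodule.span_le]
    rintro _ ⟨m, hm, hlt, rfl⟩
    rw [SetLike.mem_coe, LinearMap.mem_ker]
    rcases stdBracketing_eq_zero_or_isBoundedWord hm with h0 | ⟨j, n, -, hmle, y, hy, hbm⟩
    · rw [h0, map_zero]
    rw [hbm, loopEntry_loopElem]
    split_ifs with hp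
    · by_contra hne
      have hs : j.support i.row i.col = true := by
        by_contra hs
        exact hne (hy _ _ (by simpa using hs))
      obtain ⟨rfl, rfl | ⟨hi, rfl⟩⟩ := eq_and_power_eq_of_support hs (by exact_mod_cast hp)
      · exact absurd hmle (not_le.2 hlt)
      · rcases hi with rfl | rfl
        · exact absurd (hmle.trans (word_im2_lt_word_im1 n).le) (not_le.2 hlt)
        · exact absurd hmle (not_le.2 hlt)
    · rfl
  have := LinearMap.mem_ker.1 (hle hmem)
  rw [hb, loopEntry_loopElem, if_pos rfl] at this
  exact hx.2 this

/-- There are no other standard words. -/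
theorem exists_eq_word {w : List AffineLetter}
    (hw : IsStandardLyndonWord ℂ affineGenerator w) : ∃ i k, w = word i k := by
  obtain ⟨hL, hmem⟩ := hw
  by_contra hne
  push Not at hne
  refine hmem ?_
  rcases stdBracketing_eq_zero_or_isBoundedWord hL with h0 | ⟨i, k, -, hle, x, hx, hb⟩
  · rw [h0]; exact Submodule.zero_mem _
  have hlt := lt_of_le_of_ne hle (hne i k)
  have hspan (j : RootType) (h : w < word j k) :
      stdBracketing affineGenerator (word j k) ∈ Submodule.span ℂ
        {x | ∃ m, IsLyndonWord m ∧ w < m ∧ stdBracketing affineGenerator m = x} :=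
    Submodule.subset_span ⟨_, (isGenericWord_word j k).isLyndonWord, h, rfl⟩
  rw [hb]
  have hmain (j : RootType) (hj : j ≠ im2) (h : w < word j k) {x : SL3} (hx : j.Mem x) :
      loopElem x ((k + j.coeff l0 : ℕ) : ℤ) ∈ Submodule.span ℂ
        {x | ∃ m, IsLyndonWord m ∧ w < m ∧ stdBracketing affineGenerator m = x} := by
    obtain ⟨y, hy, hby⟩ := (isGenericWord_word j k).exists_memGen
    rw [hx.eq_smul hj hy, loopElem_smul, ← hby]
    exact Submodule.smul_mem _ _ (hspan j h)
  -- A word below the `im2` word is also below the `im1` word, so both bracketings are available to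
  -- span the Cartan part. For the other types, one listed word spans the line.
  by_cases hi : i = im2
  · subst hi
    obtain ⟨y, hy, hby⟩ := (isGenericWord_word im2 k).exists_memGen
    rw [← sub_add_cancel x ((x.val 0 0 / y.val 0 0) • y), loopElem_add]
    refine Submodule.add_mem _ (hmain im1 (by decide) (hlt.trans (word_im2_lt_word_im1 k))
      (hx.im1_sub hy)) ?_
    rw [loopElem_smul, ← hby]
    exact Submodule.smul_mem _ _ (hspan im2 hlt)
  · exact hmain i hi hlt hx

/-- Linear independence is unaffected by the injective inclusion of the positive subalgebra, so
standardness can be tested in the whole affine algebra. -/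
theorem isAffineStandardLyndon_iff {w : List AffineLetter} :
    IsAffineStandardLyndon w ↔ ∃ i k, w = word i k := by
  let f : affineNilPos →ₗ[ℂ] AffineSL3 := affineNilPos.incl
  have hf : Function.Injective f := Subtype.val_injective
  have hcoe (w : List AffineLetter) :
      f (stdBracketing affineE w) =
        stdBracketing affineGenerator w :=
    map_stdBracketing affineE f.toAddMonoidHom (fun _ _ => rfl) w
  have h : IsAffineStandardLyndon w ↔ IsStandardLyndonWord ℂ affineGenerator w := by
    refine and_congr_right fun _ => not_congr ?_
    rw [← Submodule.apply_mem_span_image_iff_mem_span (f := f) hf, hcoe]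
    have himage : f ''
        {x | ∃ m, IsLyndonWord m ∧ w < m ∧ stdBracketing affineE m = x} =
        {x | ∃ m, IsLyndonWord m ∧ w < m ∧ stdBracketing affineGenerator m = x} := by
      ext x
      constructor
      · rintro ⟨_, ⟨m, hm, hlt, rfl⟩, rfl⟩
        exact ⟨m, hm, hlt, (hcoe m).symm⟩
      · rintro ⟨m, hm, hlt, rfl⟩
        exact ⟨_, ⟨m, hm, hlt, rfl⟩, hcoe m⟩
    rw [← himage]
  rw [h]
  constructor
  · exact exists_eq_word
  · rintro ⟨i, k, rfl⟩
    exact isStandardLyndonWord_word i k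

/-! ### Degrees of the standard words. -/

theorem wordDegree_word_eq (i : RootType) (k : ℕ) :
    wordDegree (word i k) = k • deltaRoot + i.coeff := by
  ext l
  rw [wordDegree_word]
  cases l <;> simp [deltaRoot, simpleRoot]

theorem coeff_a1 : coeff a1 = simpleRoot l1 := by ext l; cases l <;> rfl
theorem coeff_a2 : coeff a2 = simpleRoot l2 := by ext l; cases l <;> rfl
theorem coeff_a0 : coeff a0 = simpleRoot l0 := by ext l; cases l <;> rfl
theorem coeff_a12 : coeff a12 = simpleRoot l1 + simpleRoot l2 := by ext l; cases l <;> rfl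
theorem coeff_a10 : coeff a10 = simpleRoot l1 + simpleRoot l0 := by ext l; cases l <;> rfl
theorem coeff_a20 : coeff a20 = simpleRoot l2 + simpleRoot l0 := by ext l; cases l <;> rfl
theorem coeff_im1 : coeff im1 = deltaRoot := by ext l; cases l <;> rfl
theorem coeff_im2 : coeff im2 = deltaRoot := by ext l; cases l <;> rfl

theorem affineSL_of_not_isImag {i : RootType} (hi : ¬ i.IsImag) (k : ℕ) :
    AffineSL (k • deltaRoot + i.coeff) [word i k] := by
  refine ⟨List.pairwise_singleton _ _, fun w => ?_⟩
  rw [List.mem_singleton, isAffineStandardLyndon_iff, ← wordDegree_word_eq]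
  constructor
  · rintro rfl
    exact ⟨⟨i, k, rfl⟩, rfl⟩
  · rintro ⟨⟨j, m, rfl⟩, h⟩
    obtain ⟨rfl, rfl | h⟩ := eq_of_wordDegree_eq h
    · rfl
    · exact absurd h.2 hi

theorem affineSL_imag (k : ℕ) : AffineSL ((k + 1) • deltaRoot) [word im1 k, word im2 k] := by
  refine ⟨List.pairwise_pair.2 (word_im2_lt_word_im1 k), fun w => ?_⟩
  have h1 : (k + 1) • deltaRoot = wordDegree (word im1 k) := by
    rw [wordDegree_word_eq, coeff_im1, succ_nsmul]
  have h2 : wordDegree (word im2 k) = wordDegree (word im1 k) := by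
    rw [wordDegree_word_eq, wordDegree_word_eq, coeff_im1, coeff_im2]
  rw [isAffineStandardLyndon_iff, h1, List.mem_pair]
  constructor
  · rintro (rfl | rfl)
    · exact ⟨⟨_, k, rfl⟩, rfl⟩
    · exact ⟨⟨_, k, rfl⟩, h2⟩
  · rintro ⟨⟨j, m, rfl⟩, h⟩
    obtain ⟨rfl, rfl | ⟨rfl | rfl, -⟩⟩ := eq_of_wordDegree_eq h <;> simp

theorem wordDegree_word_mem (i : RootType) (k : ℕ) :
    wordDegree (word i k) ∈ posRealRoots ∪ posImagRoots := by
  rw [wordDegree_word_eq]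
  cases i
  · exact Or.inl ⟨k, Or.inl ⟨l1, by rw [coeff_a1]⟩⟩
  · exact Or.inl ⟨k, Or.inl ⟨l2, by rw [coeff_a2]⟩⟩
  · exact Or.inl ⟨k, Or.inl ⟨l0, by rw [coeff_a0]⟩⟩
  · exact Or.inl ⟨k, Or.inr ⟨l1, l2, by decide, by rw [coeff_a12]⟩⟩
  · exact Or.inl ⟨k, Or.inr ⟨l1, l0, by decide, by rw [coeff_a10]⟩⟩
  · exact Or.inl ⟨k, Or.inr ⟨l2, l0, by decide, by rw [coeff_a20]⟩⟩
  · exact Or.inr ⟨k, by rw [coeff_im1, succ_nsmul]⟩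
  · exact Or.inr ⟨k, by rw [coeff_im2, succ_nsmul]⟩

end RootType

open RootType
/-- The affine standard Lyndon words for affine `sl₃` with the order `1 < 2 < 0`. -/
theorem mainTheorem3 :
    -- only positive roots occur as degrees of affine standard Lyndon words
    (∀ w, IsAffineStandardLyndon w → wordDegree w ∈ posRealRoots ∪ posImagRoots) ∧
    -- the formulas for k ≥ 1
    (∀ k : ℕ, 1 ≤ k →
      AffineSL (k • deltaRoot + simpleRoot .l1)
        [[.l1, .l2] ++ rep102 (k - 1) ++ [.l1, .l0]] ∧
      AffineSL (k • deltaRoot + simpleRoot .l2) [rep102 k ++ [.l2]] ∧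
      AffineSL (k • deltaRoot + simpleRoot .l0) [rep102 k ++ [.l0]] ∧
      AffineSL (k • deltaRoot + (simpleRoot .l1 + simpleRoot .l2)) [[.l1, .l2] ++ rep102 k] ∧
      AffineSL (k • deltaRoot + (simpleRoot .l1 + simpleRoot .l0)) [[.l1, .l0] ++ rep102 k] ∧
      (Even k → AffineSL (k • deltaRoot + (simpleRoot .l2 + simpleRoot .l0))
        [rep102 (k / 2) ++ [.l2] ++ rep102 (k / 2) ++ [.l0]]) ∧
      (Odd k → AffineSL (k • deltaRoot + (simpleRoot .l2 + simpleRoot .l0))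
        [rep102 ((k + 1) / 2) ++ [.l0] ++ rep102 ((k - 1) / 2) ++ [.l2]]) ∧
      AffineSL ((k + 1) • deltaRoot)
        [[.l1, .l0] ++ rep102 k ++ [.l2], [.l1, .l2] ++ rep102 k ++ [.l0]]) ∧
    -- the remaining roots
    AffineSL (simpleRoot .l1) [[.l1]] ∧
    AffineSL (simpleRoot .l2) [[.l2]] ∧
    AffineSL (simpleRoot .l0) [[.l0]] ∧
    AffineSL (simpleRoot .l1 + simpleRoot .l2) [[.l1, .l2]] ∧
    AffineSL (simpleRoot .l1 + simpleRoot .l0) [[.l1, .l0]] ∧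
    AffineSL (simpleRoot .l2 + simpleRoot .l0) [[.l2, .l0]] ∧
    AffineSL deltaRoot [[.l1, .l0, .l2], [.l1, .l2, .l0]] := by

  have hreal (i : RootType) (hi : ¬ i.IsImag) (k : ℕ) := affineSL_of_not_isImag hi k
  have hzero (i : RootType) (hi : ¬ i.IsImag) : AffineSL i.coeff [word i 0] := by
    simpa using affineSL_of_not_isImag hi 0
  refine ⟨?_, fun k hk => ⟨?_, ?_, ?_, ?_, ?_, fun hk => ?_, fun hk => ?_, affineSL_imag k⟩,
    ?_, ?_, ?_, ?_, ?_, ?_, ?_⟩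
  · intro w hw
    obtain ⟨i, k, rfl⟩ := isAffineStandardLyndon_iff.1 hw
    exact wordDegree_word_mem i k
  · obtain ⟨k, rfl⟩ : ∃ n, k = n + 1 := ⟨k - 1, by omega⟩
    rw [← coeff_a1]
    exact hreal a1 (by decide) (k + 1)
  · rw [← coeff_a2]
    exact hreal a2 (by decide) k
  · rw [← coeff_a0]
    exact hreal a0 (by decide) k
  · rw [← coeff_a12]
    exact hreal a12 (by decide) k
  · rw [← coeff_a10]
    exact hreal a10 (by decide) k
  · have h := hreal a20 (by decide) k
    rwa [word, if_pos hk, coeff_a20] at h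
  · have h := hreal a20 (by decide) k
    rwa [word, if_neg (Nat.not_even_iff_odd.2 hk), coeff_a20] at h
  · rw [← coeff_a1]
    exact hzero a1 (by decide)
  · rw [← coeff_a2]
    exact hzero a2 (by decide)
  · rw [← coeff_a0]
    exact hzero a0 (by decide)
  · rw [← coeff_a12]
    exact hzero a12 (by decide)
  · rw [← coeff_a10]
    exact hzero a10 (by decide)
  · rw [← coeff_a20]
    exact hzero a20 (by decide)
  · have h := affineSL_imag 0
    rwa [zero_add, one_smul] at h
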